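/- Let $d\ge 1$ and let $\mathcal M_d$ be the space of complex $d\times d$ matrices with the Hilbert–Schmidt inner product $\langle A,B\rangle=\mathrm{Tr}(A^\dagger B)$. A quantum channel on $\mathcal M_d$ is a linear, completely positive, trace-preserving map $\mathcal M_d\to\mathcal M_d$, and a Lindblad generator is a linear map $L:\mathcal M_d\to\mathcal M_d$ such that $e^{tL}$ is a quantum channel for every $t\ge 0$. Let $\mathcal I_d$ be the set of linear maps $T:\mathcal M_d\to\mathcal M_d$ such that for every $\varepsilon>0$ there are $n\in\mathbb N$ and Lindblad generators $G_1,\dots,G_n$ with $\|e^{G_j}-\mathrm{id}\|\le\varepsilon$ for all $j$ and $\prod_{j=1}^n e^{G_j}=T$. The elements of the closure $\overline{\mathcal I}_d$ are called the infinitesimal Markovian divisible quantum channels. For a linear map $T:\mathcal M_d\to\mathcal M_d$ let $s_1^\uparrow(T)\le\dots\le s_{d^2}^\uparrow(T)$ be its singular values in increasing order, counted with multiplicity. Then for every $T\in\overline{\mathcal I}_d$ the determinant of $T$ (as a linear map on the $d^2$-dimensional space $\mathcal M_d$) is real and $$0\le \det(T)\le\prod_{i=1}^{\lfloor 2d-2\sqrt{2d}+1\rfloor}s_i^\uparrow(T),$$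 where the empty product (the case $d=1$) equals $1$. -/

import Mathlib

open scoped ComplexOrder Matrix

/- Complex matrices carry the Hilbert--Schmidt (Frobenius) norm. -/
attribute [local instance] Matrix.frobeniusNormedAddCommGroup Matrix.frobeniusNormedSpace

namespace QuantumDivisibility

/-- The space `M_d` of complex `d × d` matrices. -/
abbrev Mat (d : ℕ) : Type := Matrix (Fin d) (Fin d) ℂ

/-- The topology of `M_d` is the one of the norm (it is also the entrywise topology). -/
noncomputable instance matTopology (d : ℕ) : TopologicalSpace (Mat d) :=
  Matrix.frobeniusNormedAddCommGroup.toPseudoMetricSpace.toUniformSpace.toTopologicalSpace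

/-- The Hilbert--Schmidt inner product `⟪A, B⟫ = Tr (A† B)` on `M_d`. Its norm is the
Frobenius norm, and adjoints and singular values of superoperators refer to it. -/
noncomputable instance hilbertSchmidt (d : ℕ) : InnerProductSpace ℂ (Mat d) where
  inner A B := (Aᴴ * B).trace
  norm_sq_eq_re_inner A := by
    have h : (0 : ℝ) ≤ ∑ i, ∑ j, ‖A i j‖ ^ (2 : ℝ) := by positivity
    rw [Matrix.frobenius_norm_def, ← Real.sqrt_eq_rpow, Real.sq_sqrt h, Finset.sum_comm]
    simp only [Matrix.trace, Matrix.diag_apply, Matrix.mul_apply, Matrix.conjTranspose_apply,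
      map_sum]
    refine Finset.sum_congr rfl fun i _ => Finset.sum_congr rfl fun j _ => ?_
    rw [Real.rpow_two, ← Complex.normSq_eq_norm_sq, Complex.normSq_apply]
    simp
  conj_inner_symm A B := by
    rw [starRingEnd_apply, ← Matrix.trace_conjTranspose, Matrix.conjTranspose_mul,
      Matrix.conjTranspose_conjTranspose]
  add_left A B C := by
    rw [Matrix.conjTranspose_add, Matrix.add_mul, Matrix.trace_add]
  smul_left A B r := by
    rw [Matrix.conjTranspose_smul, Matrix.smul_mul, Matrix.trace_smul, smul_eq_mul,
      starRingEnd_apply]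

/-- Linear maps `M_d → M_d`. All of them are continuous; the bundled continuous ones are used
because they form a normed algebra under the operator norm, with composition as product. -/
abbrev Superop (d : ℕ) : Type := Mat d →L[ℂ] Mat d

/-- The map `T ⊗ id` on `M_d ⊗ M_n`, the matrices indexed by `Fin d × Fin n`: the `(a, b)` block
of the image of `X`, for `a b : Fin n`, is the image under `T` of the `(a, b)` block of `X`. -/
noncomputable def ampliation {d : ℕ} (T : Superop d) (n : ℕ) (X : Matrix (Fin d × Fin n) (Fin d × Fin n) ℂ) :
    Matrix (Fin d × Fin n) (Fin d × Fin n) ℂ :=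
  Matrix.of fun p q => T (Matrix.of fun i j => X (i, p.2) (j, q.2)) p.1 q.1

/-- `T` is completely positive: every `T ⊗ id_{M_n}` preserves positive semidefiniteness. -/
def IsCompletelyPositive {d : ℕ} (T : Superop d) : Prop :=
  ∀ (n : ℕ) (X : Matrix (Fin d × Fin n) (Fin d × Fin n) ℂ),
    X.PosSemidef → (ampliation T n X).PosSemidef

/-- A quantum channel on `M_d`: a linear, completely positive, trace-preserving map. -/
def IsQuantumChannel {d : ℕ} (T : Superop d) : Prop :=
  IsCompletelyPositive T ∧ ∀ ρ : Mat d, (T ρ).trace = ρ.trace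

/-- The set of Lindblad generators on `M_d`: the linear maps `L` which generate a continuous
dynamical semigroup `t ↦ exp (t L)`, `t ≥ 0`, of quantum channels. -/
noncomputable def lindbladGenerators (d : ℕ) : Set (Superop d) :=
  {L | ∀ t : ℝ, 0 ≤ t → IsQuantumChannel (NormedSpace.exp ((t : ℂ) • L))}

/-- The set `I_𝒢` for a set `𝒢` of generators: those `T` which, for every `ε > 0`, are a finite
product `exp (G_1) ⋯ exp (G_n)` with all `G_j` in `𝒢` and all `‖exp (G_j) - 1‖ ≤ ε`. -/
noncomputable def infinitesimalProducts {d : ℕ} (𝒢 : Set (Superop d)) : Set (Superop d) :=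
  {T | ∀ ε : ℝ, 0 < ε → ∃ (n : ℕ) (G : Fin n → Superop d),
    (∀ j, G j ∈ 𝒢) ∧ (∀ j, ‖NormedSpace.exp (G j) - 1‖ ≤ ε) ∧
      (List.ofFn fun j => NormedSpace.exp (G j)).prod = T}

/-- `T` is an infinitesimal Markovian divisible quantum channel: it lies in the closure of `I_𝒢`
for `𝒢` the set of Lindblad generators. -/
def IsInfinitesimalMarkovianDivisible {d : ℕ} (T : Superop d) : Prop :=
  T ∈ closure (infinitesimalProducts (lindbladGenerators d))

/-- The determinant of a linear map `M_d → M_d`. -/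
noncomputable def superDet {d : ℕ} (T : Superop d) : ℂ :=
  LinearMap.det (T : Mat d →ₗ[ℂ] Mat d)

/-- The `i`-th smallest singular value `s_i^↑(T)`, for `1 ≤ i ≤ d²`, counted with multiplicity.
(`LinearMap.singularValues` lists the `d²` singular values in decreasing order, from index `0`.) -/
noncomputable def singularValueAsc {d : ℕ} (T : Superop d) (i : ℕ) : ℝ :=
  (T : Mat d →ₗ[ℂ] Mat d).singularValues (d ^ 2 - i)

end QuantumDivisibility

/-!
Write `s₁ ≥ s₂ ≥ …` for the singular values of `T`, let `k` be the number of factors in the product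
and `m = d² - k`. Since `|det T| = ∏ sᵢ`, the upper bound follows from `s₁ ⋯ s_m ≤ 1`, that is, from
`T` not increasing the volumes of parallelepipeds spanned by `m` matrices
(`IsVolumeContraction`, phrased with Gram determinants). This property is closed and stable under
products, so it is enough to have it for `T = exp G` with `G` a Lindblad generator. For these it
follows from the infinitesimal condition that the trace of the Hermitian part of `G` over every
`m`-dimensional subspace is nonpositive (`isVolumeContraction_exp`).

For that condition, `G ρ = ∑ L ρ L† + K ρ + ρ K†` with traceless `L` and
`∑ L† L + K + K† = 0` (`exists_isLindbladForm`), so that `Re tr G = -d ∑ ‖L‖²`. On the orthogonal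
complement of the given subspace, with orthonormal basis `Y₁, …, Y_k`, each `L` contributes to
`-∑ Re ⟪Y_b, G Y_b⟫` at most

* `(k + 1) / 2 · ‖L‖²` through `Y ↦ (L† L Y + Y L† L) / 2`: its eigenvalues are the averages
  `(aᵢ + aⱼ) / 2` of two eigenvalues of `L† L`, hence at most `‖L‖² / 2` for `i ≠ j`, and the excess
  `∑ aᵢ / 2` from `i = j` is again `‖L‖² / 2`;
* `√k · ‖L‖²` through `Y ↦ L Y L†`, whose Hilbert--Schmidt norm is `‖L‖²`.

The sum is `(√k + 1)² / 2 · ‖L‖²` (`dissipation_le`). It is at most `d ‖L‖²` precisely when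
`k ≤ (√(2d) - 1)² = 2d - 2√(2d) + 1`, and then the trace over the `m`-dimensional subspace is
nonpositive.

The determinant is real because channels commute with `ρ ↦ ρ†`, and nonnegative because `exp G` is
the square of the channel `exp (G / 2)`.
-/

/-! ### Gram determinants and volume contraction -/

namespace VolumeContraction

open Module Filter Topology

variable {E : Type*} [NormedAddCommGroup E] [InnerProductSpace ℂ E]
variable {n : Type*} [Fintype n]

lemma gram_sum_smul (v : n → E) (A : Matrix n n ℂ) :
    Matrix.gram ℂ (fun i => ∑ j, A j i • v j) = Aᴴ * Matrix.gram ℂ v * A := by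
  ext i j
  simp only [Matrix.gram_apply, Matrix.mul_apply, Matrix.conjTranspose_apply, sum_inner, inner_sum,
    inner_smul_left, inner_smul_right, Finset.mul_sum, Finset.sum_mul, starRingEnd_apply]
  exact Finset.sum_congr rfl fun k _ => Finset.sum_congr rfl fun l _ => by ring

variable [DecidableEq n]

/-- Apply `x ≤ exp (x - 1)` to each eigenvalue. -/
lemma det_re_le_exp_trace_sub_card {H : Matrix n n ℂ} (hH : H.PosSemidef) :
    H.det.re ≤ Real.exp (H.trace.re - Fintype.card n) := by
  rw [hH.isHermitian.det_eq_prod_eigenvalues, hH.isHermitian.trace_eq_sum_eigenvalues]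
  have h1 : ((∏ i, (hH.isHermitian.eigenvalues i : ℂ)).re) = ∏ i, hH.isHermitian.eigenvalues i := by
    rw [← Complex.ofReal_prod, Complex.ofReal_re]
  have h2 : ((∑ i, (hH.isHermitian.eigenvalues i : ℂ)).re) - Fintype.card n
      = ∑ i, (hH.isHermitian.eigenvalues i - 1) := by
    rw [← Complex.ofReal_sum, Complex.ofReal_re]; simp
  erw [h1, h2, Real.exp_sum]
  refine Finset.prod_le_prod (fun i _ => hH.eigenvalues_nonneg i) fun i _ => ?_
  simpa using Real.add_one_le_exp (hH.isHermitian.eigenvalues i - 1)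

open scoped MatrixOrder Matrix.Norms.L2Operator in
lemma exists_eq_conjTranspose_mul_self {S : Matrix n n ℂ} (hS : S.PosSemidef) :
    ∃ B : Matrix n n ℂ, S = Bᴴ * B :=
  CStarAlgebra.nonneg_iff_eq_star_mul_self.mp hS.nonneg

lemma exists_conjTranspose_mul_mul_eq_one {S : Matrix n n ℂ} (hS : S.PosDef) :
    ∃ A : Matrix n n ℂ, Aᴴ * S * A = 1 := by
  obtain ⟨B, rfl⟩ := exists_eq_conjTranspose_mul_self hS.posSemidef
  have hB : IsUnit B.det := by
    have h := (Matrix.isUnit_iff_isUnit_det _).1 hS.isUnit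
    rw [Matrix.det_mul] at h
    exact isUnit_of_mul_isUnit_right h
  refine ⟨B⁻¹, ?_⟩
  rw [← mul_assoc, ← Matrix.conjTranspose_mul, Matrix.mul_nonsing_inv B hB,
    Matrix.conjTranspose_one, one_mul, Matrix.mul_nonsing_inv B hB]

lemma det_gram_nonneg (v : n → E) : 0 ≤ (Matrix.gram ℂ v).det :=
  (Matrix.posSemidef_gram ℂ v).det_nonneg

/-- A bound on the squared volumes of the images of orthonormal systems scales to all systems,
since any linearly independent system is an invertible combination of an orthonormal one. -/
lemma det_gram_map_le {T : E →ₗ[ℂ] E} {c : ℝ}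
    (h : ∀ u : n → E, Orthonormal ℂ u → (Matrix.gram ℂ (T ∘ u)).det.re ≤ c) (v : n → E) :
    (Matrix.gram ℂ (T ∘ v)).det.re ≤ c * (Matrix.gram ℂ v).det.re := by
  by_cases hv : (Matrix.gram ℂ v).det = 0
  · have : (Matrix.gram ℂ (T ∘ v)).det = 0 := by
      by_contra hT
      rw [← ne_eq, Matrix.det_gram_ne_zero_iff_linearIndependent] at hT
      exact (Matrix.det_gram_ne_zero_iff_linearIndependent.2 hT.of_comp) hv
    simp [hv, this]
  · obtain ⟨A, hA⟩ := exists_conjTranspose_mul_mul_eq_one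
      ((Matrix.posSemidef_gram ℂ v).posDef_iff_det_ne_zero.2 hv)
    have hu := h (fun i => ∑ j, A j i • v j)
      (Matrix.gram_eq_one_iff_orthonormal.1 (by rw [gram_sum_smul, hA]))
    have hTu : T ∘ (fun i => ∑ j, A j i • v j) = fun i => ∑ j, A j i • (T ∘ v) j := by
      ext i; simp
    rw [hTu, gram_sum_smul, Matrix.det_mul, Matrix.det_mul, Matrix.det_conjTranspose] at hu
    have hdet := congrArg Matrix.det hA
    rw [Matrix.det_mul, Matrix.det_mul, Matrix.det_conjTranspose, Matrix.det_one] at hdet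
    have hnn := det_gram_nonneg (v := v)
    have key : ∀ z : ℂ, (star A.det * z * A.det).re = Complex.normSq A.det * z.re := by
      intro z
      simp [Complex.normSq_apply]; ring
    rw [key] at hu
    have hre := congrArg Complex.re hdet
    rw [key, Complex.one_re] at hre
    have hpos : 0 ≤ (Matrix.gram ℂ v).det.re := (Complex.le_def.1 hnn).1
    calc _ = (Complex.normSq A.det * (Matrix.gram ℂ (T ∘ v)).det.re) *
          (Matrix.gram ℂ v).det.re := by
            linear_combination (-(Matrix.gram ℂ (T ∘ v)).det.re) * hre
      _ ≤ _ := mul_le_mul_of_nonneg_right hu hpos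

variable (m : ℕ)

/-- `T` does not increase the (squared) volume of any parallelepiped spanned by `m` vectors;
equivalently, the `m`-th exterior power of `T` is a contraction. -/
def IsVolumeContraction (T : E →L[ℂ] E) : Prop :=
  ∀ v : Fin m → E, (Matrix.gram ℂ (T ∘ v)).det.re ≤ (Matrix.gram ℂ v).det.re

variable {m}

lemma IsVolumeContraction.one : IsVolumeContraction m (1 : E →L[ℂ] E) := fun _ => le_rfl

lemma IsVolumeContraction.mul {S T : E →L[ℂ] E} (hS : IsVolumeContraction m S)
    (hT : IsVolumeContraction m T) : IsVolumeContraction m (S * T) :=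
  fun v => (hS (T ∘ v)).trans (hT v)

lemma isClosed_isVolumeContraction : IsClosed {T : E →L[ℂ] E | IsVolumeContraction m T} := by
  simp only [IsVolumeContraction, Set.ofPred_forall]
  refine isClosed_iInter fun v => isClosed_le ?_ continuous_const
  refine Complex.continuous_re.comp (Continuous.matrix_det ?_)
  refine continuous_matrix fun i j => ?_
  simp only [Matrix.gram_apply, Function.comp]
  fun_prop

/-- If `A` is close to `1 + s G`, the partial traces of `A† A` are controlled by those of `G`. -/
lemma sum_norm_sq_le {G A : E →L[ℂ] E} {s : ℝ} (hs : 0 ≤ s) {u : Fin m → E} (hu : Orthonormal ℂ u)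
    (hG : ∑ i, (inner ℂ (u i) (G (u i))).re ≤ 0) :
    ∑ i, ‖A (u i)‖ ^ 2 ≤ m + m * (2 * ‖A - 1 - (s : ℂ) • G‖ + ‖A - 1‖ ^ 2) := by
  have h1 : ∀ i, ‖A (u i)‖ ^ 2 ≤ 1 + 2 * s * (inner ℂ (u i) (G (u i))).re
      + (2 * ‖A - 1 - (s : ℂ) • G‖ + ‖A - 1‖ ^ 2) := by
    intro i
    have hn : ‖u i‖ = 1 := hu.1 i
    have e1 : A (u i) = u i + (A - 1) (u i) := by simp
    have e2 : (A - 1) (u i) = (s : ℂ) • G (u i) + (A - 1 - (s : ℂ) • G) (u i) := by simp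
    have e3 : ‖(A - 1) (u i)‖ ^ 2 ≤ ‖A - 1‖ ^ 2 := by
      have := (A - 1).le_opNorm (u i)
      rw [hn, mul_one] at this
      gcongr
    have e4 : (inner ℂ (u i) ((A - 1 - (s : ℂ) • G) (u i))).re ≤ ‖A - 1 - (s : ℂ) • G‖ := by
      refine (Complex.re_le_norm _).trans ((norm_inner_le_norm _ _).trans ?_)
      have := (A - 1 - (s : ℂ) • G).le_opNorm (u i)
      rw [hn, mul_one] at this
      rwa [hn, one_mul]
    have e5 : (inner ℂ (u i) ((A - 1) (u i))).re = s * (inner ℂ (u i) (G (u i))).re +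
        (inner ℂ (u i) ((A - 1 - (s : ℂ) • G) (u i))).re := by
      rw [e2, inner_add_right, inner_smul_right, Complex.add_re, Complex.re_ofReal_mul]
    have e6 : ‖u i + (A - 1) (u i)‖ ^ 2 = 1 + 2 * (inner ℂ (u i) ((A - 1) (u i))).re
        + ‖(A - 1) (u i)‖ ^ 2 := by
      have := @norm_add_sq ℂ E _ _ _ (u i) ((A - 1) (u i))
      rw [hn, one_pow] at this
      exact this
    rw [e1, e6, e5]
    linarith
  calc _ ≤ ∑ i, (1 + 2 * s * (inner ℂ (u i) (G (u i))).re
      + (2 * ‖A - 1 - (s : ℂ) • G‖ + ‖A - 1‖ ^ 2)) := Finset.sum_le_sum fun i _ => h1 i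
    _ = m + 2 * s * ∑ i, (inner ℂ (u i) (G (u i))).re +
        m * (2 * ‖A - 1 - (s : ℂ) • G‖ + ‖A - 1‖ ^ 2) := by
      simp only [Finset.sum_add_distrib, ← Finset.mul_sum, Finset.sum_const, Finset.card_univ,
        Fintype.card_fin, nsmul_eq_mul, mul_one]
      ring
    _ ≤ _ := by nlinarith

lemma tendsto_natCast_smul_exp_sub_one [CompleteSpace E] (G : E →L[ℂ] E) :
    Tendsto (fun k : ℕ => (k : ℂ) • (NormedSpace.exp ((k : ℂ)⁻¹ • G) - 1)) atTop (𝓝 G) := by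
  have h := (hasDerivAt_exp_smul_const G (0 : ℂ)).tendsto_slope_zero
  have h0 : Tendsto (fun k : ℕ => ((k : ℂ))⁻¹) atTop (𝓝[≠] 0) := by
    refine tendsto_nhdsWithin_iff.2 ⟨tendsto_inv_atTop_nhds_zero_nat, ?_⟩
    filter_upwards [eventually_gt_atTop 0] with k hk
    simp [hk.ne']
  simpa [Function.comp_def] using h.comp h0

/-- If the partial traces of the Hermitian part of `G` over all `m`-dimensional subspaces are
nonpositive, then `e^G` contracts `m`-dimensional volumes. Cutting `e^G` into `k` factors, each
factor dilates volumes at most by `exp (o (1 / k))`. -/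
theorem isVolumeContraction_exp [CompleteSpace E] {G : E →L[ℂ] E}
    (hG : ∀ u : Fin m → E, Orthonormal ℂ u → ∑ i, (inner ℂ (u i) (G (u i))).re ≤ 0) :
    IsVolumeContraction m (NormedSpace.exp G) := by
  set a : ℕ → E →L[ℂ] E := fun k => NormedSpace.exp ((k : ℂ)⁻¹ • G) with ha
  set h : ℕ → ℝ := fun k => m * (2 * ‖a k - 1 - (k : ℂ)⁻¹ • G‖ + ‖a k - 1‖ ^ 2) with hh
  have step : ∀ k v, (Matrix.gram ℂ (a k ∘ v)).det.re ≤
      Real.exp (h k) * (Matrix.gram ℂ (v : Fin m → E)).det.re := by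
    intro k v
    refine det_gram_map_le (T := (a k : E →ₗ[ℂ] E)) (fun u hu => ?_) v
    refine (det_re_le_exp_trace_sub_card (Matrix.posSemidef_gram ℂ _)).trans
      (Real.exp_le_exp.2 ?_)
    have h1 := sum_norm_sq_le (A := a k) (s := (k : ℝ)⁻¹) (by positivity) hu (hG u hu)
    have h2 : (Matrix.gram ℂ ((a k : E →ₗ[ℂ] E) ∘ u)).trace.re = ∑ i, ‖a k (u i)‖ ^ 2 := by
      simp only [Matrix.trace, Matrix.diag_apply, Matrix.gram_apply, Complex.re_sum]
      refine Finset.sum_congr rfl fun i _ => ?_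
      exact inner_self_eq_norm_sq (𝕜 := ℂ) _
    rw [h2]
    push_cast at h1
    simp only [Fintype.card_fin, hh]
    linarith
  have iter : ∀ (k j : ℕ) (v : Fin m → E), (Matrix.gram ℂ ((a k ^ j : E →L[ℂ] E) ∘ v)).det.re ≤
      Real.exp (j * h k) * (Matrix.gram ℂ (v : Fin m → E)).det.re := by
    intro k j
    induction j with
    | zero => intro v; simp
    | succ j ih =>
      intro v
      rw [pow_succ]
      calc _ ≤ _ := ih (a k ∘ v)
        _ ≤ _ := mul_le_mul_of_nonneg_left (step k v) (Real.exp_nonneg _)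
        _ = _ := by rw [← mul_assoc, ← Real.exp_add]; push_cast; ring_nf
  have hpow : ∀ k : ℕ, k ≠ 0 → a k ^ k = NormedSpace.exp G := by
    intro k hk
    let +nondep : NormedAlgebra ℚ (E →L[ℂ] E) := .restrictScalars ℚ ℂ _
    rw [ha, ← NormedSpace.exp_nsmul, ← Nat.cast_smul_eq_nsmul ℂ, smul_smul,
      mul_inv_cancel₀ (by exact_mod_cast hk), one_smul]
  have hlim : Tendsto (fun k : ℕ => (k : ℝ) * h k) atTop (𝓝 0) := by
    have t1 := tendsto_natCast_smul_exp_sub_one G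
    have t2 : Tendsto (fun k : ℕ => m * (2 * ‖(k : ℂ) • (a k - 1) - G‖ +
        ‖(k : ℂ) • (a k - 1)‖ ^ 2 * (k : ℝ)⁻¹)) atTop
        (𝓝 (m * (2 * ‖G - G‖ + ‖G‖ ^ 2 * 0))) :=
      ((((t1.sub_const G).norm).const_mul 2).add ((t1.norm.pow 2).mul
        tendsto_inv_atTop_nhds_zero_nat)).const_mul _
    simp only [sub_self, norm_zero, mul_zero, add_zero] at t2
    refine t2.congr' ?_
    filter_upwards [eventually_gt_atTop 0] with k hk
    have hk' : (k : ℂ) ≠ 0 := by exact_mod_cast hk.ne'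
    have hkr : (k : ℝ) ≠ 0 := by exact_mod_cast hk.ne'
    have e : (k : ℂ) • (a k - 1) - G = (k : ℂ) • (a k - 1 - (k : ℂ)⁻¹ • G) := by
      rw [smul_sub _ (a k - 1), smul_smul, mul_inv_cancel₀ hk', one_smul]
    rw [e, norm_smul, norm_smul, Complex.norm_natCast, hh]
    field_simp
  intro v
  have t3 : Tendsto (fun k : ℕ => Real.exp (k * h k) * (Matrix.gram ℂ v).det.re) atTop
      (𝓝 (Real.exp 0 * (Matrix.gram ℂ v).det.re)) :=
    ((Real.continuous_exp.tendsto 0).comp hlim).mul_const _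
  rw [Real.exp_zero, one_mul] at t3
  refine ge_of_tendsto t3 ?_
  filter_upwards [eventually_gt_atTop 0] with k hk
  rw [← hpow k hk.ne']
  exact iter k k v

variable [FiniteDimensional ℂ E]

/-- The product of the `m` largest singular values is the largest dilation of `m`-dimensional
volumes, attained on the leading right singular vectors. -/
lemma IsVolumeContraction.prod_singularValues_le_one {T : E →L[ℂ] E}
    (hT : IsVolumeContraction m T) (hm : m ≤ finrank ℂ E) :
    ∏ i ∈ Finset.range m, (T : E →ₗ[ℂ] E).singularValues i ≤ 1 := by
  set f : E →ₗ[ℂ] E := T.toLinearMap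
  set b := f.isSymmetric_adjoint_comp_self.eigenvectorBasis rfl with hb
  set v : Fin m → E := fun i => b (Fin.castLE hm i) with hv
  have h1 : Matrix.gram ℂ v = 1 := Matrix.gram_eq_one_iff_orthonormal.2
    (b.orthonormal.comp _ (Fin.castLE_injective hm))
  have h2 : Matrix.gram ℂ (T ∘ v) = Matrix.diagonal fun i : Fin m =>
      ((f.singularValues i ^ 2 : ℝ) : ℂ) := by
    ext i j
    have e : inner ℂ (f (v i)) (f (v j)) = inner ℂ (v i) ((LinearMap.adjoint f ∘ₗ f) (v j)) := by
      simp [LinearMap.adjoint_inner_right]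
    have e' := congrFun (congrFun h1 i) j
    rw [Matrix.gram_apply] at e' ⊢
    change inner ℂ (f (v i)) (f (v j)) = _
    rw [e, hv, LinearMap.IsSymmetric.apply_eigenvectorBasis, inner_smul_right]
    have : f.singularValues j ^ 2 = f.isSymmetric_adjoint_comp_self.eigenvalues rfl
      (Fin.castLE hm j) := f.sq_singularValues_fin rfl (Fin.castLE hm j)
    rw [← this]
    erw [e']
    by_cases hij : i = j <;> simp [hij, Matrix.one_apply]
  have h3 := hT v
  rw [h1, h2, Matrix.det_diagonal, Matrix.det_one, ← Complex.ofReal_prod, Complex.ofReal_re,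
    Finset.prod_pow, Complex.one_re, Fin.prod_univ_eq_prod_range (fun i => f.singularValues i)] at h3
  have hnn : 0 ≤ ∏ i ∈ Finset.range m, f.singularValues i :=
    Finset.prod_nonneg fun i _ => f.singularValues_nonneg i
  nlinarith

lemma IsVolumeContraction.norm_det_le {T : E →L[ℂ] E}
    (hT : IsVolumeContraction m T) (hm : m ≤ finrank ℂ E) :
    ‖LinearMap.det (T : E →ₗ[ℂ] E)‖ ≤
      ∏ i ∈ Finset.Ico m (finrank ℂ E), (T : E →ₗ[ℂ] E).singularValues i := by
  rw [← LinearMap.normDet_eq_norm_det, LinearMap.normDet_eq_prod_singularValues,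
    ← Finset.prod_range_mul_prod_Ico _ hm]
  exact mul_le_of_le_one_left (Finset.prod_nonneg fun i _ => LinearMap.singularValues_nonneg _ i)
    (hT.prod_singularValues_le_one hm)

end VolumeContraction

/-! ### The dissipation inequality -/

namespace QuantumDivisibility

variable {d k : ℕ}

lemma inner_eq_trace (A B : Mat d) : inner ℂ A B = (Aᴴ * B).trace := rfl

lemma inner_eq_sum (A B : Mat d) : inner ℂ A B = ∑ i, ∑ j, star (A i j) * B i j := by
  rw [inner_eq_trace, Finset.sum_comm]
  simp [Matrix.trace, Matrix.mul_apply]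

lemma norm_sq_eq_sum (A : Mat d) : ‖A‖ ^ 2 = ∑ i, ∑ j, ‖A i j‖ ^ 2 := by
  have h := inner_self_eq_norm_sq (𝕜 := ℂ) A
  rw [← h, inner_eq_sum, map_sum]
  refine Finset.sum_congr rfl fun i _ => ?_
  rw [map_sum]
  refine Finset.sum_congr rfl fun j _ => ?_
  rw [← Complex.normSq_eq_norm_sq, Complex.normSq_apply]
  simp

lemma norm_sq_eq_re_trace (A : Mat d) : ‖A‖ ^ 2 = (Aᴴ * A).trace.re :=
  (inner_self_eq_norm_sq (𝕜 := ℂ) A).symm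

/-- Bessel's inequality, with the orthonormal system in the second argument. -/
lemma sum_norm_inner_sq_le {Y : Fin k → Mat d} (hY : Orthonormal ℂ Y) (Z : Mat d) :
    ∑ b, ‖inner ℂ Z (Y b)‖ ^ 2 ≤ ‖Z‖ ^ 2 := by
  simp_rw [norm_inner_symm Z]
  exact hY.sum_inner_products_le Z

lemma sum_norm_entry_sq_le {Y : Fin k → Mat d} (hY : Orthonormal ℂ Y) (i j : Fin d) :
    ∑ b, ‖Y b i j‖ ^ 2 ≤ 1 := by
  have h := sum_norm_inner_sq_le hY (Matrix.single i j 1)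
  have h1 : ‖(Matrix.single i j 1 : Mat d)‖ ^ 2 = 1 := by
    rw [norm_sq_eq_sum, Finset.sum_eq_single i, Finset.sum_eq_single j] <;>
      simp +contextual [Matrix.single_apply, eq_comm]
  have h2 : ∀ b, inner ℂ (Matrix.single i j 1 : Mat d) (Y b) = Y b i j := by
    intro b
    rw [inner_eq_sum, Finset.sum_eq_single i, Finset.sum_eq_single j] <;>
      simp +contextual [Matrix.single_apply, eq_comm]
  simpa [h1, h2] using h

/-- The eigenvalues `a i + a j` of `Y ↦ D Y + Y D` for the diagonal `D` exceed the trace of `D`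
only for `i = j`, and there by at most `a i`. -/
lemma sum_weighted_entries_le {Y : Fin k → Mat d} (hY : Orthonormal ℂ Y) {a : Fin d → ℝ}
    (ha : ∀ i, 0 ≤ a i) :
    ∑ b, ∑ i, ∑ j, (a i + a j) * ‖Y b i j‖ ^ 2 ≤ (k + 1) * ∑ i, a i := by
  have h1 : ∀ b, ∑ i, ∑ j, (a i + a j) * ‖Y b i j‖ ^ 2 ≤
      ∑ i, a i + ∑ i, a i * ‖Y b i i‖ ^ 2 := by
    intro b
    calc _ ≤ ∑ i, ∑ j, ((∑ l, a l) * ‖Y b i j‖ ^ 2 +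
          if i = j then a i * ‖Y b i j‖ ^ 2 else 0) := by
          refine Finset.sum_le_sum fun i _ => Finset.sum_le_sum fun j _ => ?_
          split_ifs with hij
          · subst hij
            have : a i ≤ ∑ l, a l := Finset.single_le_sum (fun l _ => ha l) (Finset.mem_univ i)
            nlinarith [sq_nonneg ‖Y b i i‖]
          · have : a i + a j ≤ ∑ l, a l := by
              rw [← Finset.sum_pair hij]
              exact Finset.sum_le_sum_of_subset_of_nonneg (Finset.subset_univ _) fun l _ _ => ha l
            nlinarith [sq_nonneg ‖Y b i j‖]
      _ = (∑ l, a l) * ‖Y b‖ ^ 2 + ∑ i, a i * ‖Y b i i‖ ^ 2 := by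
          rw [norm_sq_eq_sum]
          simp [Finset.sum_add_distrib, Finset.mul_sum]
      _ = _ := by rw [hY.1 b]; ring
  calc _ ≤ ∑ b : Fin k, (∑ i, a i + ∑ i, a i * ‖Y b i i‖ ^ 2) := Finset.sum_le_sum fun b _ => h1 b
    _ = k * ∑ i, a i + ∑ i, a i * ∑ b, ‖Y b i i‖ ^ 2 := by
        rw [Finset.sum_add_distrib]
        simp only [Finset.sum_const, Finset.card_univ, Fintype.card_fin, nsmul_eq_mul,
          Finset.mul_sum]
        rw [Finset.sum_comm (s := Finset.univ (α := Fin k))]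
    _ ≤ k * ∑ i, a i + ∑ i, a i * 1 := by
        gcongr with i
        · exact ha i
        · exact sum_norm_entry_sq_le hY i i
    _ = _ := by simp; ring

lemma sum_norm_mul_sq_le {Y : Fin k → Mat d} (hY : Orthonormal ℂ Y) (L : Mat d) :
    ∑ b, (‖L * Y b‖ ^ 2 + ‖Y b * Lᴴ‖ ^ 2) ≤ (k + 1) * ‖L‖ ^ 2 := by
  have hA : (Lᴴ * L).PosSemidef := Matrix.posSemidef_conjTranspose_mul_self L
  set a := hA.isHermitian.eigenvalues with ha
  set U : Mat d := hA.isHermitian.eigenvectorUnitary.1 with hU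
  have hUU : U * Uᴴ = 1 := Unitary.mul_star_self_of_mem hA.isHermitian.eigenvectorUnitary.2
  have hspec : Lᴴ * L = U * Matrix.diagonal (fun i => (a i : ℂ)) * Uᴴ := hA.isHermitian.spectral_theorem
  set W : Fin k → Mat d := fun b => Uᴴ * Y b * U with hW
  have hWo : Orthonormal ℂ W := by
    rw [orthonormal_iff_ite] at hY ⊢
    intro b c
    rw [← hY b c, inner_eq_trace, inner_eq_trace, hW]
    simp only [Matrix.conjTranspose_mul, Matrix.conjTranspose_conjTranspose]
    calc (Uᴴ * ((Y b)ᴴ * U) * (Uᴴ * Y c * U)).trace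
        = (Uᴴ * ((Y b)ᴴ * (U * Uᴴ) * Y c * U)).trace := by simp only [mul_assoc]
      _ = _ := by rw [Matrix.trace_mul_comm, hUU, mul_one, mul_assoc, hUU, mul_one]
  have hsum : ∑ i, a i = ‖L‖ ^ 2 := by
    rw [norm_sq_eq_re_trace, hA.isHermitian.trace_eq_sum_eigenvalues]
    simp [ha]
  rw [← hsum]
  refine le_trans (le_of_eq ?_) (sum_weighted_entries_le hWo fun i => hA.eigenvalues_nonneg i)
  refine Finset.sum_congr rfl fun b _ => ?_
  have h1 : ‖L * Y b‖ ^ 2 = ((W b)ᴴ * Matrix.diagonal (fun i => (a i : ℂ)) * W b).trace.re := by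
    rw [norm_sq_eq_re_trace, Matrix.conjTranspose_mul]
    congr 1
    calc ((Y b)ᴴ * Lᴴ * (L * Y b)).trace = ((Y b)ᴴ * (Lᴴ * L) * Y b * (U * Uᴴ)).trace := by
          rw [hUU, mul_one]; simp only [mul_assoc]
      _ = _ := by
          rw [hspec, ← mul_assoc, Matrix.trace_mul_comm, hW]
          simp only [Matrix.conjTranspose_mul, Matrix.conjTranspose_conjTranspose, mul_assoc]
  have h2 : ‖Y b * Lᴴ‖ ^ 2 = (W b * Matrix.diagonal (fun i => (a i : ℂ)) * (W b)ᴴ).trace.re := by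
    rw [norm_sq_eq_re_trace, Matrix.trace_mul_comm, Matrix.conjTranspose_mul,
      Matrix.conjTranspose_conjTranspose]
    congr 1
    calc (Y b * Lᴴ * (L * (Y b)ᴴ)).trace = (Y b * (Lᴴ * L) * (Y b)ᴴ * (U * Uᴴ)).trace := by
          rw [hUU, mul_one]; simp only [mul_assoc]
      _ = _ := by
          rw [hspec, ← mul_assoc, Matrix.trace_mul_comm, hW]
          simp only [Matrix.conjTranspose_mul, Matrix.conjTranspose_conjTranspose, mul_assoc]
  have hz : ∀ z : ℂ, ∀ r : ℝ, (star z * r * z).re = r * ‖z‖ ^ 2 := by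
    intro z r
    rw [← Complex.normSq_eq_norm_sq, Complex.normSq_apply]; simp; ring
  have hz' : ∀ z : ℂ, ∀ r : ℝ, (z * r * star z).re = r * ‖z‖ ^ 2 := by
    intro z r
    rw [← hz]; congr 1; ring
  rw [h1, h2]
  simp only [Matrix.trace, Matrix.diag_apply, Matrix.mul_apply (M := _ * Matrix.diagonal _),
    Matrix.mul_diagonal, Matrix.conjTranspose_apply, Complex.re_sum, hz, hz']
  rw [Finset.sum_comm, ← Finset.sum_add_distrib]
  simp_rw [← Finset.sum_add_distrib, add_mul]

lemma conj_entry_eq_inner (L Y : Mat d) (i j : Fin d) :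
    (L * Y * Lᴴ) i j = inner ℂ (Matrix.of fun p q => star (L i p) * L j q : Mat d) Y := by
  simp only [inner_eq_sum, Matrix.mul_apply, Matrix.of_apply, Matrix.conjTranspose_apply,
    Finset.sum_mul, star_mul, star_star]
  rw [Finset.sum_comm]
  exact Finset.sum_congr rfl fun p _ => Finset.sum_congr rfl fun q _ => by ring

/-- The Hilbert--Schmidt norm of `Y ↦ L Y L†` is `‖L‖²`. -/
lemma sum_norm_conj_sq_le {Y : Fin k → Mat d} (hY : Orthonormal ℂ Y) (L : Mat d) :
    ∑ b, ‖L * Y b * Lᴴ‖ ^ 2 ≤ (‖L‖ ^ 2) ^ 2 := by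
  calc ∑ b, ‖L * Y b * Lᴴ‖ ^ 2
      = ∑ i, ∑ j, ∑ b, ‖inner ℂ (Matrix.of fun p q => star (L i p) * L j q : Mat d) (Y b)‖ ^ 2 := by
        simp_rw [norm_sq_eq_sum, conj_entry_eq_inner]
        rw [Finset.sum_comm]
        exact Finset.sum_congr rfl fun i _ => Finset.sum_comm
    _ ≤ ∑ i, ∑ j, ‖(Matrix.of fun p q => star (L i p) * L j q : Mat d)‖ ^ 2 :=
        Finset.sum_le_sum fun i _ => Finset.sum_le_sum fun j _ => sum_norm_inner_sq_le hY _
    _ = ∑ i, ∑ j, (∑ p, ‖L i p‖ ^ 2) * ∑ q, ‖L j q‖ ^ 2 := by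
        simp_rw [norm_sq_eq_sum, Finset.sum_mul_sum]
        simp [mul_pow]
    _ = _ := by rw [norm_sq_eq_sum, sq, Finset.sum_mul_sum]

lemma neg_sum_re_inner_conj_le {Y : Fin k → Mat d} (hY : Orthonormal ℂ Y) (L : Mat d) :
    -∑ b, (inner ℂ (Y b) (L * Y b * Lᴴ)).re ≤ √k * ‖L‖ ^ 2 := by
  have h1 : -∑ b, (inner ℂ (Y b) (L * Y b * Lᴴ)).re ≤ ∑ b, ‖L * Y b * Lᴴ‖ := by
    rw [← Finset.sum_neg_distrib]
    refine Finset.sum_le_sum fun b _ => ?_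
    calc _ ≤ ‖inner ℂ (Y b) (L * Y b * Lᴴ)‖ := (neg_le_abs _).trans (Complex.abs_re_le_norm _)
      _ ≤ ‖Y b‖ * ‖L * Y b * Lᴴ‖ := norm_inner_le_norm _ _
      _ = _ := by rw [hY.1 b, one_mul]
  refine h1.trans ?_
  have h2 : (∑ b, ‖L * Y b * Lᴴ‖) ^ 2 ≤ (√k * ‖L‖ ^ 2) ^ 2 := by
    refine sq_sum_le_card_mul_sum_sq.trans ?_
    rw [mul_pow, Real.sq_sqrt (Nat.cast_nonneg k), Finset.card_univ, Fintype.card_fin]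
    gcongr
    exact sum_norm_conj_sq_le hY L
  exact le_of_sq_le_sq h2 (by positivity)

/-- The partial trace of the dissipator of a jump operator `L` over the span of an orthonormal system
of `k` matrices is at least `-(√k + 1)² ‖L‖² / 2`. -/
lemma dissipation_le {Y : Fin k → Mat d} (hY : Orthonormal ℂ Y) (L : Mat d) :
    ∑ b, (2⁻¹ * (‖L * Y b‖ ^ 2 + ‖Y b * Lᴴ‖ ^ 2) - (inner ℂ (Y b) (L * Y b * Lᴴ)).re) ≤
      2⁻¹ * (√k + 1) ^ 2 * ‖L‖ ^ 2 := by
  rw [Finset.sum_sub_distrib, ← Finset.mul_sum]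
  have h1 := sum_norm_mul_sq_le hY L
  have h2 := neg_sum_re_inner_conj_le hY L
  have h3 : (√k) ^ 2 = (k : ℝ) := Real.sq_sqrt (Nat.cast_nonneg k)
  nlinarith

/-- The Lindblad form of `G`: traceless jump operators `L p`, and a drift `K` that makes `G`
annihilate traces. -/
structure IsLindbladForm {ι : Type*} [Fintype ι] (G : Superop d) (L : ι → Mat d) (K : Mat d) :
    Prop where
  apply_eq : ∀ ρ, G ρ = ∑ p, L p * ρ * (L p)ᴴ + K * ρ + ρ * Kᴴ
  trace_eq_zero : ∀ p, (L p).trace = 0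
  sum_add : ∑ p, (L p)ᴴ * L p + K + Kᴴ = 0

lemma trace_eq_sum_entries (G : Superop d) :
    LinearMap.trace ℂ (Mat d) G = ∑ i, ∑ j, G (Matrix.single i j 1) i j := by
  rw [LinearMap.trace_eq_matrix_trace ℂ (Matrix.stdBasis ℂ (Fin d) (Fin d)), Matrix.trace,
    Fintype.sum_prod_type]
  refine Finset.sum_congr rfl fun i _ => Finset.sum_congr rfl fun j _ => ?_
  rw [Matrix.diag_apply, LinearMap.toMatrix_apply, Matrix.stdBasis_eq_single]
  simp [Matrix.stdBasis]

namespace IsLindbladForm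

variable {ι : Type*} [Fintype ι] {G : Superop d} {L : ι → Mat d} {K : Mat d}

lemma trace_re (h : IsLindbladForm G L K) :
    (LinearMap.trace ℂ (Mat d) G).re = -(d * ∑ p, ‖L p‖ ^ 2) := by
  have h1 : LinearMap.trace ℂ (Mat d) G =
      ∑ p, (L p).trace * star (L p).trace + d * K.trace + d * Kᴴ.trace := by
    rw [trace_eq_sum_entries]
    simp only [h.apply_eq, Matrix.add_apply, Matrix.sum_apply, Finset.sum_add_distrib]
    congr 1
    · congr 1
      · simp only [Matrix.trace, star_sum, Finset.sum_mul_sum, Matrix.diag_apply]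
        rw [Finset.sum_congr rfl fun i _ => Finset.sum_comm, Finset.sum_comm]
        refine Finset.sum_congr rfl fun p _ => Finset.sum_congr rfl fun i _ =>
          Finset.sum_congr rfl fun j _ => ?_
        simp [Matrix.mul_apply, Matrix.single_apply, ite_and]
      · simp [Matrix.mul_apply, Matrix.single_apply, Matrix.trace, Finset.mul_sum]
    · simp [Matrix.mul_apply, Matrix.single_apply, Matrix.trace]
  have h2 := congrArg Matrix.trace h.sum_add
  rw [Matrix.trace_add, Matrix.trace_add, Matrix.trace_sum, Matrix.trace_zero] at h2
  have h3 := congrArg Complex.re h2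
  simp only [Complex.add_re, Complex.re_sum, ← norm_sq_eq_re_trace, Complex.zero_re] at h3
  rw [h1]
  simp only [h.trace_eq_zero, zero_mul, Finset.sum_const_zero, zero_add, Complex.add_re,
    Complex.mul_re, Complex.natCast_re, Complex.natCast_im, sub_zero]
  linear_combination (d : ℝ) * h3

lemma re_inner_apply (h : IsLindbladForm G L K) (Y : Mat d) :
    (inner ℂ Y (G Y)).re = -∑ p, (2⁻¹ * (‖L p * Y‖ ^ 2 + ‖Y * (L p)ᴴ‖ ^ 2) -
      (inner ℂ Y (L p * Y * (L p)ᴴ)).re) := by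
  have hK : K + Kᴴ = -∑ p, (L p)ᴴ * L p := by
    rw [eq_neg_iff_add_eq_zero, add_comm, ← add_assoc]; exact h.sum_add
  have conj_re : ∀ A : Mat d, Aᴴ.trace.re = A.trace.re := by
    intro A; rw [Matrix.trace_conjTranspose]; simp
  have e1 : 2 * (inner ℂ Y (K * Y)).re = -∑ p, ‖L p * Y‖ ^ 2 := by
    have : (inner ℂ Y (K * Y)).re = (Yᴴ * (Kᴴ * Y)).trace.re := by
      rw [inner_eq_trace, ← conj_re]; simp [mul_assoc]
    rw [two_mul]
    nth_rw 2 [this]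
    rw [inner_eq_trace, ← Complex.add_re, ← Matrix.trace_add, ← mul_add, ← add_mul, hK]
    simp only [neg_mul, mul_neg, Finset.sum_mul, Finset.mul_sum, Matrix.trace_neg,
      Matrix.trace_sum, Complex.neg_re, Complex.re_sum, norm_sq_eq_re_trace,
      Matrix.conjTranspose_mul, mul_assoc]
  have e2 : 2 * (inner ℂ Y (Y * Kᴴ)).re = -∑ p, ‖Y * (L p)ᴴ‖ ^ 2 := by
    have : (inner ℂ Y (Y * Kᴴ)).re = (K * (Yᴴ * Y)).trace.re := by
      rw [inner_eq_trace, ← conj_re]; simp [mul_assoc]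
    have h' : (inner ℂ Y (Y * Kᴴ)).re = (Kᴴ * (Yᴴ * Y)).trace.re := by
      rw [inner_eq_trace, ← mul_assoc, Matrix.trace_mul_comm]
    rw [two_mul]
    nth_rw 1 [this]
    rw [h', ← Complex.add_re, ← Matrix.trace_add, ← add_mul, hK]
    simp only [neg_mul, Finset.sum_mul, Matrix.trace_neg,
      Matrix.trace_sum, Complex.neg_re, Complex.re_sum, norm_sq_eq_re_trace,
      Matrix.conjTranspose_mul, Matrix.conjTranspose_conjTranspose]
    refine neg_inj.2 (Finset.sum_congr rfl fun p _ => congrArg Complex.re ?_)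
    rw [mul_assoc, Matrix.trace_mul_comm]
    simp only [mul_assoc]
  rw [h.apply_eq, inner_add_right, inner_add_right, inner_sum, Complex.add_re, Complex.add_re,
    Complex.re_sum, Finset.sum_sub_distrib, ← Finset.mul_sum, Finset.sum_add_distrib]
  linarith

/-- The trace of a Lindblad generator is `-d ∑ ‖L p‖²`, which dominates its partial traces on
subspaces of dimension `k` as soon as `(√k + 1)² ≤ 2 d`. -/
lemma trace_re_le_partial_trace (h : IsLindbladForm G L K) (hk : (√k + 1) ^ 2 ≤ 2 * (d : ℝ))
    {Y : Fin k → Mat d} (hY : Orthonormal ℂ Y) :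
    (LinearMap.trace ℂ (Mat d) G).re ≤ ∑ b, (inner ℂ (Y b) (G (Y b))).re := by
  simp_rw [h.trace_re, h.re_inner_apply, Finset.sum_neg_distrib]
  rw [neg_le_neg_iff, Finset.sum_comm, Finset.mul_sum]
  refine Finset.sum_le_sum fun p _ => (dissipation_le hY (L p)).trans ?_
  have := sq_nonneg ‖L p‖
  nlinarith

lemma sum_re_inner_nonpos (h : IsLindbladForm G L K) {m : ℕ} (hmk : m + k = d ^ 2)
    (hk : (√k + 1) ^ 2 ≤ 2 * (d : ℝ)) {u : Fin m → Mat d} (hu : Orthonormal ℂ u) :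
    ∑ i, (inner ℂ (u i) (G (u i))).re ≤ 0 := by
  have hcard : Module.finrank ℂ (Mat d) = Fintype.card (Fin m ⊕ Fin k) := by
    simp [Module.finrank_matrix, hmk, sq]
  obtain ⟨b, hb⟩ := Orthonormal.exists_orthonormalBasis_extension_of_card_eq (𝕜 := ℂ) hcard
    (v := Sum.elim u 0) (s := Set.range Sum.inl) (by
      have : Orthonormal ℂ (fun x : Set.range (Sum.inl : Fin m → Fin m ⊕ Fin k) =>
          u ((Equiv.ofInjective _ Sum.inl_injective).symm x)) :=
        hu.comp _ (Equiv.injective _)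
      convert this using 1
      ext1 ⟨_, i, rfl⟩
      simp [Equiv.ofInjective_symm_apply])
  have htr := congrArg Complex.re ((G : Mat d →ₗ[ℂ] Mat d).trace_eq_sum_inner b)
  rw [Fintype.sum_sum_type, Complex.add_re, Complex.re_sum, Complex.re_sum] at htr
  have hle := h.trace_re_le_partial_trace hk (b.orthonormal.comp _ Sum.inr_injective)
  have : ∀ i, b (Sum.inl i) = u i := fun i => hb _ ⟨i, rfl⟩
  simp only [this, ContinuousLinearMap.coe_coe] at htr
  simp only [Function.comp] at hle
  linarith

end IsLindbladForm

end QuantumDivisibility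

/-! ### Lindblad generators have Lindblad form -/

namespace QuantumDivisibility

open Filter Topology VolumeContraction

variable {d : ℕ}

/-- The Choi matrix of `T`: its `(a, b)` block is the image of the matrix unit `E a b`. -/
noncomputable def choi (T : Superop d) : Matrix (Fin d × Fin d) (Fin d × Fin d) ℂ :=
  Matrix.of fun p q => T (Matrix.single p.2 q.2 1) p.1 q.1

/-- The unnormalized maximally entangled vector `∑ i, e i ⊗ e i`. -/
def maxEntangled (d : ℕ) : Fin d × Fin d → ℂ := fun p => if p.1 = p.2 then 1 else 0

lemma star_maxEntangled : star (maxEntangled d) = maxEntangled d := by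
  ext p; by_cases h : p.1 = p.2 <;> simp [maxEntangled, h]

lemma dotProduct_maxEntangled (v : Fin d × Fin d → ℂ) : v ⬝ᵥ maxEntangled d = ∑ i, v (i, i) := by
  simp [dotProduct, maxEntangled, Fintype.sum_prod_type]

lemma choi_one : choi (1 : Superop d) = Matrix.vecMulVec (maxEntangled d) (maxEntangled d) := by
  ext ⟨i, a⟩ ⟨j, b⟩
  simp only [choi, Matrix.of_apply, one_apply_eq_self, Matrix.single_apply,
    Matrix.vecMulVec_apply, maxEntangled, eq_comm (a := i), eq_comm (a := j)]
  by_cases h1 : a = i <;> by_cases h2 : b = j <;> simp [h1, h2]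

lemma choi_sub (S T : Superop d) : choi (S - T) = choi S - choi T := by
  ext; simp [choi]

lemma choi_smul (c : ℂ) (T : Superop d) : choi (c • T) = c • choi T := by
  ext; simp [choi]

lemma continuous_apply_entry (ρ : Mat d) (i j : Fin d) :
    Continuous fun T : Superop d => T ρ i j := by
  have h : Continuous (Matrix.entryLinearMap ℂ ℂ i j : Mat d →ₗ[ℂ] ℂ) :=
    LinearMap.continuous_of_finiteDimensional _
  exact h.comp (continuous_id.clm_apply continuous_const)

lemma apply_entry (T : Superop d) (ρ : Mat d) (i j : Fin d) :
    T ρ i j = ∑ a, ∑ b, ρ a b * choi T (i, a) (j, b) := by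
  conv_lhs => rw [Matrix.matrix_eq_sum_single ρ]
  simp only [map_sum, Matrix.sum_apply]
  refine Finset.sum_congr rfl fun a _ => Finset.sum_congr rfl fun b _ => ?_
  have : (Matrix.single a b (ρ a b) : Mat d) = ρ a b • Matrix.single a b 1 := by simp
  rw [this, map_smul]
  simp [choi]

lemma IsCompletelyPositive.choi_posSemidef {T : Superop d} (hT : IsCompletelyPositive T) :
    (choi T).PosSemidef := by
  have h := hT d _ (Matrix.posSemidef_vecMulVec_self_star (maxEntangled d))
  convert h using 1
  ext ⟨i, a⟩ ⟨j, b⟩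
  rw [star_maxEntangled, ← choi_one]
  rfl

/-- A generator lies in every closed set containing the difference quotients of its semigroup. -/
lemma mem_of_isClosed_of_exp {G : Superop d} {S : Set (Superop d)} (hS : IsClosed S)
    (h : ∀ (k : ℕ), (k : ℂ) • (NormedSpace.exp ((k : ℂ)⁻¹ • G) - 1) ∈ S) : G ∈ S :=
  hS.mem_of_tendsto (tendsto_natCast_smul_exp_sub_one G) (Eventually.of_forall h)

section Generators

variable {G : Superop d} (hG : G ∈ lindbladGenerators d)
include hG

lemma isQuantumChannel_exp_inv_smul (k : ℕ) :
    IsQuantumChannel (NormedSpace.exp ((k : ℂ)⁻¹ • G)) := by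
  have := hG ((k : ℝ)⁻¹) (by positivity)
  push_cast at this
  exact this

lemma choi_isHermitian_of_mem : (choi G).IsHermitian := by
  have hcl : IsClosed {T : Superop d | ∀ p q, star (choi T q p) = choi T p q} := by
    simp only [Set.ofPred_forall]
    exact isClosed_iInter fun p => isClosed_iInter fun q =>
      isClosed_eq (continuous_apply_entry _ _ _).star (continuous_apply_entry _ _ _)
  refine Matrix.IsHermitian.ext fun p q => mem_of_isClosed_of_exp hcl (fun k p q => ?_) p q
  have h1 := (isQuantumChannel_exp_inv_smul hG k).1.choi_posSemidef.isHermitian.apply p q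
  rw [choi_smul, choi_sub, choi_one, Matrix.smul_apply, Matrix.smul_apply, Matrix.sub_apply,
    Matrix.sub_apply, star_smul, star_sub, h1]
  have h2 : ∀ p, star (maxEntangled d p) = maxEntangled d p := congrFun star_maxEntangled
  simp [Matrix.vecMulVec_apply, -Complex.star_def, h2, mul_comm]

lemma trace_apply_eq_zero_of_mem (ρ : Mat d) : (G ρ).trace = 0 := by
  have hcl : IsClosed {T : Superop d | (T ρ).trace = 0} :=
    isClosed_eq (continuous_finsetSum _ fun i _ => continuous_apply_entry ρ i i) continuous_const
  refine mem_of_isClosed_of_exp hcl fun k => ?_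
  change Matrix.trace ((k : ℂ) • ((NormedSpace.exp ((k : ℂ)⁻¹ • G)) ρ - ρ)) = 0
  rw [Matrix.trace_smul, Matrix.trace_sub, (isQuantumChannel_exp_inv_smul hG k).2, sub_self,
    smul_zero]

/-- Conditional complete positivity: the Choi matrix of a generator is positive on the orthogonal
complement of the maximally entangled vector, where the Choi matrix of the identity vanishes. -/
lemma choi_nonneg_of_mem {v : Fin d × Fin d → ℂ} (hv : v ⬝ᵥ maxEntangled d = 0) :
    0 ≤ star v ⬝ᵥ choi G *ᵥ v := by
  have hcl : IsClosed {T : Superop d | 0 ≤ star v ⬝ᵥ choi T *ᵥ v} := by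
    refine isClosed_le continuous_const ?_
    simp only [dotProduct, Matrix.mulVec]
    exact continuous_finsetSum _ fun p _ => continuous_const.mul
      (continuous_finsetSum _ fun q _ => (continuous_apply_entry _ _ _).mul continuous_const)
  refine mem_of_isClosed_of_exp hcl fun k => ?_
  have h1 := (isQuantumChannel_exp_inv_smul hG k).1.choi_posSemidef.dotProduct_mulVec_nonneg v
  have h2 : (Matrix.vecMulVec (maxEntangled d) (maxEntangled d)) *ᵥ v = 0 := by
    rw [Matrix.vecMulVec_mulVec, dotProduct_comm, hv]; simp
  change 0 ≤ star v ⬝ᵥ choi _ *ᵥ v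
  rw [choi_smul, choi_sub, choi_one, Matrix.smul_mulVec, Matrix.sub_mulVec, h2, sub_zero,
    dotProduct_smul, smul_eq_mul]
  exact mul_nonneg (by positivity) h1

/-- Lindblad's theorem in finite dimension. With `P` the projection onto the maximally entangled
vector and `C` the Choi matrix of `G`, the compression `(1 - P) C (1 - P) = B† B` gives the jump
operators, and the remainder `R + R†`, with `R = (C - P C / 2) P`, gives the drift. -/
theorem exists_isLindbladForm (hd : 0 < d) :
    ∃ (L : Fin d × Fin d → Mat d) (K : Mat d), IsLindbladForm G L K := by
  have hd' : (d : ℂ) ≠ 0 := by exact_mod_cast hd.ne'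
  set Ω := maxEntangled d with hΩ
  set C := choi G with hC
  have hCH : Cᴴ = C := choi_isHermitian_of_mem hG
  set P : Matrix (Fin d × Fin d) (Fin d × Fin d) ℂ := (d : ℂ)⁻¹ • Matrix.vecMulVec Ω Ω with hP
  have hPH : Pᴴ = P := by
    rw [hP, Matrix.conjTranspose_smul, Matrix.conjTranspose_vecMulVec, star_maxEntangled]
    simp [hΩ]
  have hΩΩ : Ω ⬝ᵥ Ω = d := by
    rw [dotProduct_maxEntangled]; simp [hΩ, maxEntangled]
  have hPΩ : P *ᵥ Ω = Ω := by
    rw [hP, Matrix.smul_mulVec, Matrix.vecMulVec_mulVec, hΩΩ]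
    ext p
    simp
    field_simp
  have hQH : (1 - P)ᴴ = 1 - P := by rw [Matrix.conjTranspose_sub, hPH, Matrix.conjTranspose_one]
  have hQv : ∀ v, ((1 - P) *ᵥ v) ⬝ᵥ Ω = 0 := by
    intro v
    rw [Matrix.sub_mulVec, Matrix.one_mulVec, sub_dotProduct, hP, Matrix.smul_mulVec,
      Matrix.vecMulVec_mulVec, smul_dotProduct, op_smul_eq_smul, smul_dotProduct, hΩΩ,
      dotProduct_comm Ω v]
    simp
    field_simp
    simp
  have hM : ((1 - P) * C * (1 - P)).PosSemidef := by
    refine Matrix.posSemidef_iff_dotProduct_mulVec.2 ⟨?_, fun v => ?_⟩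
    · rw [Matrix.IsHermitian, Matrix.conjTranspose_mul, Matrix.conjTranspose_mul, hQH, hCH,
        mul_assoc]
    · have := choi_nonneg_of_mem hG (hQv v)
      rwa [Matrix.star_mulVec, hQH, ← Matrix.dotProduct_mulVec, Matrix.mulVec_mulVec,
        Matrix.mulVec_mulVec] at this
  obtain ⟨B, hB⟩ := exists_eq_conjTranspose_mul_self hM
  have hBΩ : B *ᵥ Ω = 0 := by
    rw [← Matrix.conjTranspose_mul_self_mulVec_eq_zero, ← hB, ← Matrix.mulVec_mulVec,
      Matrix.sub_mulVec, hPΩ]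
    simp
  set N := C - (2 : ℂ)⁻¹ • (P * C) with hN
  have hsplit : C = Bᴴ * B + N * P + (N * P)ᴴ := by
    rw [← hB, Matrix.conjTranspose_mul, hPH, hN, Matrix.conjTranspose_sub,
      Matrix.conjTranspose_smul, Matrix.conjTranspose_mul, hPH, hCH]
    have h2 : star (2 : ℂ)⁻¹ = 2⁻¹ := by simp
    rw [h2]
    simp only [sub_mul, mul_sub, one_mul, mul_one, smul_mul_assoc, mul_smul_comm, mul_assoc]
    module
  set K : Mat d := Matrix.of fun i a => (d : ℂ)⁻¹ * (N *ᵥ Ω) (i, a) with hK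
  have hNP : ∀ p q, (N * P) p q = K p.1 p.2 * Ω q := by
    intro p q
    rw [hP, Matrix.mul_smul, Matrix.mul_vecMulVec]
    simp [hK, Matrix.vecMulVec_apply, mul_assoc]
  set L : Fin d × Fin d → Mat d := fun p => Matrix.of fun i a => star (B p (i, a)) with hL
  have hform : ∀ ρ, G ρ = ∑ p, L p * ρ * (L p)ᴴ + K * ρ + ρ * Kᴴ := by
    intro ρ
    ext i j
    have hentry : ∀ a b, C (i, a) (j, b) =
        ∑ p, L p i a * star (L p j b) + K i a * Ω (j, b) + Ω (i, a) * star (K j b) := by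
      intro a b
      rw [hsplit, Matrix.add_apply, Matrix.add_apply, Matrix.conjTranspose_apply, hNP, hNP,
        Matrix.mul_apply, star_mul, ← Pi.star_apply, star_maxEntangled]
      simp [hL, hΩ]
    rw [apply_entry, ← hC]
    simp only [hentry, Matrix.add_apply, Matrix.sum_apply, mul_add, Finset.sum_add_distrib]
    congr 1
    · congr 1
      · simp only [Matrix.mul_apply, Matrix.conjTranspose_apply, Finset.sum_mul, Finset.mul_sum]
        rw [Finset.sum_comm, Finset.sum_congr rfl fun b _ => Finset.sum_comm, Finset.sum_comm]
        exact Finset.sum_congr rfl fun p _ => Finset.sum_congr rfl fun b _ =>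
          Finset.sum_congr rfl fun a _ => by ring
      · simp [Matrix.mul_apply, hΩ, maxEntangled, mul_comm]
    · simp [Matrix.mul_apply, hΩ, maxEntangled]
  refine ⟨L, K, hform, fun p => ?_, ?_⟩
  · have := congrArg star (congrFun hBΩ p)
    rw [Matrix.mulVec, dotProduct_maxEntangled] at this
    simpa [hL, Matrix.trace] using this
  · rw [← Matrix.trace_mul_conjTranspose_self_eq_zero_iff]
    generalize hρ : (∑ p, (L p)ᴴ * L p + K + Kᴴ)ᴴ = ρ
    have h := trace_apply_eq_zero_of_mem hG ρ
    have hcycle : ∑ p, (L p * ρ * (L p)ᴴ).trace = ∑ p, ((L p)ᴴ * L p * ρ).trace :=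
      Finset.sum_congr rfl fun p _ => by rw [Matrix.trace_mul_comm (L p * ρ), mul_assoc]
    rw [hform, Matrix.trace_add, Matrix.trace_add, Matrix.trace_sum, hcycle] at h
    rw [add_mul, add_mul, Matrix.trace_add, Matrix.trace_add, Finset.sum_mul, Matrix.trace_sum,
      Matrix.trace_mul_comm Kᴴ, h]

end Generators

/-! ### The determinant of a divisible channel -/

lemma star_superDet_of_choi_isHermitian {T : Superop d} (hT : (choi T).IsHermitian) :
    star (superDet T) = superDet T := by
  have h : LinearMap.toMatrix (Matrix.stdBasis ℂ (Fin d) (Fin d)) (Matrix.stdBasis ℂ (Fin d) (Fin d))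
      (T : Mat d →ₗ[ℂ] Mat d) = Matrix.of fun p q => choi T (p.1, q.1) (p.2, q.2) := by
    ext p q
    rw [LinearMap.toMatrix_apply, Matrix.stdBasis_eq_single]
    simp [Matrix.stdBasis, choi]
  rw [superDet, ← LinearMap.det_toMatrix (Matrix.stdBasis ℂ (Fin d) (Fin d)), h,
    ← Matrix.det_conjTranspose, ← Matrix.det_transpose,
    ← Matrix.det_submatrix_equiv_self (Equiv.prodComm (Fin d) (Fin d))]
  congr 1
  ext p q
  exact hT.apply _ _

lemma superDet_mul (S T : Superop d) : superDet (S * T) = superDet S * superDet T :=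
  LinearMap.det_comp _ _

/-- The exponential of a generator is the square of a channel, whose determinant is real. -/
lemma superDet_exp_nonneg {G : Superop d} (hG : G ∈ lindbladGenerators d) :
    0 ≤ superDet (NormedSpace.exp G) := by
  have h1 : NormedSpace.exp G = NormedSpace.exp (((2 : ℕ) : ℂ)⁻¹ • G) ^ 2 := by
    let +nondep : NormedAlgebra ℚ (Superop d) := .restrictScalars ℚ ℂ _
    rw [← NormedSpace.exp_nsmul, ← Nat.cast_smul_eq_nsmul ℂ, smul_smul]
    simp
  have h2 := star_superDet_of_choi_isHermitian
    (isQuantumChannel_exp_inv_smul hG 2).1.choi_posSemidef.isHermitian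
  rw [h1, sq, superDet_mul]
  nth_rw 1 [← h2]
  exact star_mul_self_nonneg _

/-- A closed property of superoperators that is stable under products and holds for the exponentials
of all generators holds for all infinitesimal Markovian divisible channels. -/
lemma IsInfinitesimalMarkovianDivisible.induction {p : Superop d → Prop}
    (hcl : IsClosed {T | p T}) (h1 : p 1) (hmul : ∀ S T, p S → p T → p (S * T))
    (hexp : ∀ G ∈ lindbladGenerators d, p (NormedSpace.exp G)) {T : Superop d}
    (hT : IsInfinitesimalMarkovianDivisible T) : p T := by
  refine hcl.closure_subset_iff.2 (fun S hS => ?_) hT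
  obtain ⟨n, G, hG, -, rfl⟩ := hS 1 one_pos
  exact List.prod_induction p hmul h1 fun x hx => by
    obtain ⟨j, rfl⟩ := List.mem_ofFn.1 hx
    exact hexp _ (hG j)

lemma IsInfinitesimalMarkovianDivisible.superDet_nonneg {T : Superop d}
    (hT : IsInfinitesimalMarkovianDivisible T) : 0 ≤ superDet T :=
  hT.induction (p := fun T => 0 ≤ superDet T)
    (isClosed_le continuous_const ContinuousLinearMap.continuous_det)
    (by simp [superDet])
    (fun S T hS hT => by rw [superDet_mul]; exact mul_nonneg hS hT)
    fun G hG => superDet_exp_nonneg hG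

lemma IsInfinitesimalMarkovianDivisible.isVolumeContraction (hd : 0 < d) {T : Superop d}
    (hT : IsInfinitesimalMarkovianDivisible T) {m k : ℕ} (hmk : m + k = d ^ 2)
    (hk : (√k + 1) ^ 2 ≤ 2 * (d : ℝ)) : IsVolumeContraction m T :=
  hT.induction isClosed_isVolumeContraction .one (fun _ _ => .mul) fun _ hG => by
    obtain ⟨L, K, h⟩ := exists_isLindbladForm hG hd
    exact isVolumeContraction_exp fun u hu => h.sum_re_inner_nonpos hmk hk hu

lemma sqrt_floor_add_one_sq_le (hd : 0 < d) :
    (√(⌊2 * (d : ℝ) - 2 * √(2 * (d : ℝ)) + 1⌋₊ : ℝ) + 1) ^ 2 ≤ 2 * (d : ℝ) := by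
  have h1 : (1 : ℝ) ≤ d := by exact_mod_cast hd
  have hs : √(2 * (d : ℝ)) ^ 2 = 2 * d := Real.sq_sqrt (by positivity)
  have hs1 : 1 ≤ √(2 * (d : ℝ)) := Real.one_le_sqrt.2 (by linarith)
  have h2 : 2 * (d : ℝ) - 2 * √(2 * (d : ℝ)) + 1 = (√(2 * (d : ℝ)) - 1) ^ 2 := by
    linear_combination -hs
  have h3 : √(⌊2 * (d : ℝ) - 2 * √(2 * (d : ℝ)) + 1⌋₊ : ℝ) ≤ √(2 * (d : ℝ)) - 1 := by
    rw [h2]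
    exact (Real.sqrt_le_sqrt (Nat.floor_le (sq_nonneg _))).trans
      (Real.sqrt_sq (by linarith)).le
  calc _ ≤ √(2 * (d : ℝ)) ^ 2 := by gcongr; linarith
    _ = _ := hs

lemma le_sq_of_sqrt_add_one_sq_le {k : ℕ} (hk : (√k + 1) ^ 2 ≤ 2 * (d : ℝ)) : k ≤ d ^ 2 := by
  have h3 : √(k : ℝ) ^ 2 = k := Real.sq_sqrt (Nat.cast_nonneg k)
  have h : (k : ℝ) ≤ (d : ℝ) ^ 2 := by nlinarith [sq_nonneg ((d : ℝ) - 1), Real.sqrt_nonneg (k : ℝ)]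
  exact_mod_cast h

lemma prod_singularValueAsc {k : ℕ} (hk : k ≤ d ^ 2) (T : Superop d) :
    ∏ i ∈ Finset.Icc 1 k, singularValueAsc T i =
      ∏ i ∈ Finset.Ico (d ^ 2 - k) (d ^ 2), (T : Mat d →ₗ[ℂ] Mat d).singularValues i := by
  refine Finset.prod_nbij' (fun i => d ^ 2 - i) (fun i => d ^ 2 - i) ?_ ?_ ?_ ?_ fun _ _ => rfl <;>
    · intro i hi
      simp only [Finset.mem_Icc, Finset.mem_Ico] at *
      omega

end QuantumDivisibility

theorem corollary4p12 (d : ℕ) (hd : 0 < d) (T : QuantumDivisibility.Superop d)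
    (hT : QuantumDivisibility.IsInfinitesimalMarkovianDivisible T) :
    0 ≤ QuantumDivisibility.superDet T ∧
      QuantumDivisibility.superDet T ≤
        ((∏ i ∈ Finset.Icc 1 ⌊2 * (d : ℝ) - 2 * √(2 * (d : ℝ)) + 1⌋₊,
          QuantumDivisibility.singularValueAsc T i : ℝ) : ℂ) := by
  have h0 := hT.superDet_nonneg
  refine ⟨h0, ?_⟩
  have hk := QuantumDivisibility.sqrt_floor_add_one_sq_le hd
  generalize ⌊2 * (d : ℝ) - 2 * √(2 * (d : ℝ)) + 1⌋₊ = k at hk ⊢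
  have hkd := QuantumDivisibility.le_sq_of_sqrt_add_one_sq_le hk
  have hdim : Module.finrank ℂ (QuantumDivisibility.Mat d) = d ^ 2 := by simp [Module.finrank_matrix, sq]
  have hle := (hT.isVolumeContraction hd (Nat.sub_add_cancel hkd) hk).norm_det_le
    (by rw [hdim]; exact Nat.sub_le _ _)
  rw [hdim, ← QuantumDivisibility.prod_singularValueAsc hkd] at hle
  rw [← Complex.norm_of_nonneg' h0]
  exact Complex.real_le_real.2 hle
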